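/- Let $\mathcal A$ be a $C^*$-algebra, not necessarily unital. A $C^*$-algebra $\mathcal B$ is called type I (GCR) if $K(H)\subseteq\pi(\mathcal B)$ for every irreducible representation $\pi$ of $\mathcal B$ on a Hilbert space $H$, where $K(H)$ is the algebra of compact operators on $H$ (irreducible means: $\pi\ne 0$ and the only closed $\pi(\mathcal B)$-invariant subspaces of $H$ are $0$ and $H$). $\mathcal A$ is called residually type I if it has a separating family of $*$-homomorphisms into type I $C^*$-algebras, i.e. a family $(\varphi_i:\mathcal A\to\mathcal B_i)_{i\in I}$ of $*$-homomorphisms with all $\mathcal B_i$ type I such that for every non-zero $a\in\mathcal A$ there is $i$ with $\varphi_i(a)\neq 0$. Proposition. If the norm closure of the set of nilpotent elements of $\mathcal A$ contains a non-zero normal element, then $\mathcal A$ is not residually type I. -/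

import Mathlib

universe u v w

/-- Powers in a ring that need not have a unit: `nonUnitalPow a n` is `a ^ (n + 1)`. -/
def nonUnitalPow {A : Type u} [NonUnitalRing A] (a : A) : ℕ → A
  | 0 => a
  | n + 1 => nonUnitalPow a n * a

/-- `a` is nilpotent: `a ^ k = 0` for some `k ≥ 1`. (Mathlib's `IsNilpotent` needs a unit.) -/
def IsNilpotentElement {A : Type u} [NonUnitalRing A] (a : A) : Prop :=
  ∃ n : ℕ, nonUnitalPow a n = 0

theorem nonUnitalPow_eq_pow {A : Type u} [Ring A] (a : A) (n : ℕ) :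
    nonUnitalPow a n = a ^ (n + 1) := by
  induction n with
  | zero => simp [nonUnitalPow]
  | succ n ih => rw [nonUnitalPow, ih, ← pow_succ]

/-- In a unital ring the notion agrees with Mathlib's. -/
theorem isNilpotentElement_iff {A : Type u} [Ring A] (a : A) :
    IsNilpotentElement a ↔ IsNilpotent a := by
  simp only [IsNilpotentElement, nonUnitalPow_eq_pow]
  constructor
  · rintro ⟨n, hn⟩
    exact ⟨n + 1, hn⟩
  · rintro ⟨n, hn⟩
    exact ⟨n, by rw [pow_succ, hn, zero_mul]⟩

/-- A representation of a (not necessarily unital) C⋆-algebra on a Hilbert space is irreducible if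
it is not the zero representation and the only closed invariant subspaces are `0` and `H`. -/
structure IsIrreducibleRep {A : Type u} [NonUnitalCStarAlgebra A] {H : Type v}
    [NormedAddCommGroup H] [InnerProductSpace ℂ H] [CompleteSpace H]
    (π : A →⋆ₙₐ[ℂ] (H →L[ℂ] H)) : Prop where
  ne_zero : ∃ a : A, π a ≠ 0
  eq_bot_or_eq_top : ∀ K : Submodule ℂ H, IsClosed (K : Set H) →
    (∀ a : A, ∀ x ∈ K, π a x ∈ K) → K = ⊥ ∨ K = ⊤

/-- A C⋆-algebra is type I (GCR) if the image of each irreducible representation contains all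
compact operators. The Hilbert spaces range over the universe of `A`. This is no restriction: if
`x` is not killed by the irreducible representation `π`, then `π(A)x` is dense in `H`, so `H` is
isometrically isomorphic to a completion of a quotient of `A`. -/
def IsTypeI (A : Type u) [NonUnitalCStarAlgebra A] : Prop :=
  ∀ (H : Type u) [NormedAddCommGroup H] [InnerProductSpace ℂ H] [CompleteSpace H]
    (π : A →⋆ₙₐ[ℂ] (H →L[ℂ] H)), IsIrreducibleRep π →
      ∀ T : H →L[ℂ] H, IsCompactOperator T → ∃ a : A, π a = T

/-- A C⋆-algebra is residually type I if it has a separating family of ⋆-homomorphisms into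
type I C⋆-algebras. -/
def IsResiduallyTypeI (A : Type u) [NonUnitalCStarAlgebra A] : Prop :=
  ∃ (ι : Type w) (B : ι → Type v) (_ : ∀ i, NonUnitalCStarAlgebra (B i))
    (φ : ∀ i, A →⋆ₙₐ[ℂ] B i),
    (∀ i, IsTypeI (B i)) ∧ ∀ a : A, a ≠ 0 → ∃ i, φ i a ≠ 0

/-!
A ⋆-homomorphism maps normal limits of nilpotent elements to normal limits of nilpotent elements,
so it suffices to show that in a type I algebra `B` such an element `b` is zero
(`IsTypeI.eq_zero_of_isStarNormal`).
Suppose `‖b‖ = 1` and put `h = b⋆b`, which also has norm `1`.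

The idea is to find an irreducible representation `π` in which `π h` attains the norm `1` but has
essential norm less than `1`. By Zorn's lemma there is an ideal `J` maximal among the two-sided
ideals at distance at least `1` from `h` (`exists_maximal_idealsFarFrom`). The states that vanish
on `J` and are `1` at `h` form a nonempty weak-⋆ compact convex set; the GNS representation `π` of an
extreme point is irreducible, kills `J`, and has a unit vector fixed by `π h`
(`exists_irreducible_of_le_norm_sub`). As `B` is type I, `π⁻¹(K(H))` is strictly larger than `J`, so
by maximality it contains some `c` with `‖h - c‖ < 1`, and `π h` is at distance less than `1` from
the compact operator `π c`.

Then `1` is an isolated point of the spectrum of `(π b)⋆(π b)`: with `E` its fixed space, the normal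
operator `T = π b` is the direct sum of an isometry on `E ≠ 0` and an operator of norm less than `1`
on `Eᗮ` (`exists_lt_one_of_norm_sub_isCompactOperator_lt_one`). Every operator close to `T` maps the
cone of vectors with dominant `E`-component into itself without killing a nonzero vector of it, so
it is not nilpotent (`notMem_closure_isNilpotent_of_reduces`).
-/

open scoped ComplexOrder InnerProductSpace

/-! ### States peaking at a positive element -/

/-- The weak-⋆ dual of a complex normed space is locally convex over the reals. -/
theorem WeakDual.locallyConvexSpace_real (A : Type*) [NormedAddCommGroup A] [NormedSpace ℂ A] :
    LocallyConvexSpace ℝ (WeakDual ℂ A) := by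
  have hind : Topology.IsInducing (fun (f : WeakDual ℂ A) (x : A) => f x) := ⟨rfl⟩
  let L : WeakDual ℂ A →ₗ[ℝ] (A → ℂ) :=
    { toFun := fun f x => f x
      map_add' := fun f g => rfl
      map_smul' := fun c f => rfl }
  exact Topology.IsInducing.locallyConvexSpace (f := L) hind

section States

variable {A : Type*} [CStarAlgebra A]

/-- A functional of norm at most `1` with `f 1 = 1` is real on self-adjoint elements: `f` contracts
`a + i t` for all real `t`, and `‖a + i t‖ ^ 2 ≤ ‖a‖ ^ 2 + t ^ 2`. -/
theorem im_apply_eq_zero_of_isSelfAdjoint {f : A →L[ℂ] ℂ} (hf : ‖f‖ ≤ 1) (h1 : f 1 = 1)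
    {a : A} (ha : IsSelfAdjoint a) : (f a).im = 0 := by
  have : Nontrivial A := by
    refine ⟨⟨1, 0, fun h => ?_⟩⟩
    rw [h, map_zero] at h1
    exact zero_ne_one h1
  have key : ∀ t : ℝ, ((f a).im + t) ^ 2 ≤ ‖a‖ ^ 2 + t ^ 2 := by
    intro t
    set x : A := a + ((t : ℂ) * Complex.I) • (1 : A) with hx
    have e1 : star x * x = a * a + ((t ^ 2 : ℝ) : ℂ) • (1 : A) := by
      have : star x = a - ((t : ℂ) * Complex.I) • (1 : A) := by
        simp [hx, ha.star_eq, sub_eq_add_neg]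
      rw [this, hx]
      have h2 : ((t ^ 2 : ℝ) : ℂ) = - (((t : ℂ) * Complex.I) * ((t : ℂ) * Complex.I)) := by
        push_cast
        linear_combination ((t : ℂ) ^ 2) * Complex.I_sq
      rw [h2]
      generalize (t : ℂ) * Complex.I = c
      simp only [sub_mul, mul_add, mul_smul_comm, smul_mul_assoc, mul_one, one_mul]
      module
    have e2 : ‖x‖ ^ 2 ≤ ‖a‖ ^ 2 + t ^ 2 := by
      rw [sq, ← CStarRing.norm_star_mul_self, e1]
      refine (norm_add_le _ _).trans ?_
      rw [norm_smul, CStarRing.norm_one, mul_one, Complex.norm_real, Real.norm_eq_abs,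
        abs_of_nonneg (sq_nonneg t), sq ‖a‖]
      gcongr
      exact norm_mul_le _ _
    have e3 : f x = f a + (t : ℂ) * Complex.I := by
      rw [hx, map_add, map_smul, h1, smul_eq_mul, mul_one]
    have e4 : (f a).im + t = (f x).im := by simp [e3]
    rw [e4]
    refine le_trans ?_ e2
    rw [← sq_abs]
    gcongr
    exact (Complex.abs_im_le_norm _).trans ((f.le_opNorm x).trans
      (mul_le_of_le_one_left (norm_nonneg x) hf))
  by_contra hne
  -- The `t ^ 2` cancel in `key`, and this `t` makes the remaining linear term too large.
  have h2 := key ((‖a‖ ^ 2 + 1) / (2 * (f a).im))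
  have h3 : 2 * (f a).im * ((‖a‖ ^ 2 + 1) / (2 * (f a).im)) = ‖a‖ ^ 2 + 1 := by
    field_simp
  nlinarith [sq_nonneg (f a).im]

/-- The states of a unital C⋆-algebra that annihilate `J` and take the value `1` at `h`. States are
encoded as functionals of norm at most `1` that take the value `1` at the unit. -/
def peakStates (J : Submodule ℂ A) (h : A) : Set (WeakDual ℂ A) :=
  {f | ‖WeakDual.toStrongDual f‖ ≤ 1 ∧ f 1 = 1 ∧ (∀ j ∈ J, f j = 0) ∧ f h = 1}

theorem isCompact_peakStates (J : Submodule ℂ A) (h : A) : IsCompact (peakStates J h) := by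
  have hc := WeakDual.isCompact_closedBall (𝕜 := ℂ) (0 : StrongDual ℂ A) 1
  have e : peakStates J h = (WeakDual.toStrongDual ⁻¹' Metric.closedBall (0 : StrongDual ℂ A) 1) ∩
      ({f | f 1 = 1} ∩ ((⋂ j ∈ J, {f | f j = 0}) ∩ {f | f h = 1})) := by
    ext f
    simp [peakStates]
  rw [e]
  refine hc.inter_right (IsClosed.inter ?_ (IsClosed.inter ?_ ?_))
  · exact isClosed_eq (WeakDual.eval_continuous _) continuous_const
  · exact isClosed_biInter fun j _ => isClosed_eq (WeakDual.eval_continuous _) continuous_const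
  · exact isClosed_eq (WeakDual.eval_continuous _) continuous_const

variable [PartialOrder A] [StarOrderedRing A]

theorem apply_nonneg_of_norm_le_one {f : A →L[ℂ] ℂ} (hf : ‖f‖ ≤ 1) (h1 : f 1 = 1)
    {a : A} (ha : 0 ≤ a) : 0 ≤ f a := by
  -- `f` contracts `‖a‖ - a`, whose norm is at most `‖a‖`, so `0 ≤ re (f a)`.
  have him := im_apply_eq_zero_of_isSelfAdjoint hf h1 (IsSelfAdjoint.of_nonneg ha)
  have hn : ‖algebraMap ℝ A ‖a‖ - a‖ ≤ ‖a‖ := by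
    have hle : a ≤ algebraMap ℝ A ‖a‖ :=
      IsSelfAdjoint.le_algebraMap_norm_self (IsSelfAdjoint.of_nonneg ha)
    rw [CStarAlgebra.norm_le_iff_le_algebraMap _ (norm_nonneg a) (sub_nonneg.2 hle)]
    exact sub_le_self _ ha
  have e : f (algebraMap ℝ A ‖a‖ - a) = (‖a‖ : ℂ) - f a := by
    rw [map_sub, Algebra.algebraMap_eq_smul_one, ← Complex.coe_smul, map_smul, h1]
    simp
  have h2 : ‖(‖a‖ : ℂ) - f a‖ ≤ ‖a‖ := by
    rw [← e]
    exact ((f.le_opNorm _).trans (mul_le_of_le_one_left (norm_nonneg _) hf)).trans hn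
  have h3 := (Complex.abs_re_le_norm _).trans h2
  rw [Complex.sub_re, Complex.ofReal_re, abs_le] at h3
  rw [Complex.nonneg_iff]
  exact ⟨by linarith [h3.2], him.symm⟩

theorem norm_two_smul_sub_one_le {h : A} (h0 : 0 ≤ h) (h1 : ‖h‖ ≤ 1) :
    ‖(2 : ℂ) • h - 1‖ ≤ 1 := by
  have hle : h ≤ 1 := (CStarAlgebra.norm_le_one_iff_of_nonneg h h0).1 h1
  have hsq : h ^ 2 ≤ h ^ 1 := CStarAlgebra.pow_antitone h0 hle one_le_two
  have hs : star ((2 : ℂ) • h - 1) = (2 : ℂ) • h - 1 := by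
    simp [(IsSelfAdjoint.of_nonneg h0).star_eq]
  -- `(2 h - 1) ^ 2 = 1 - 4 (h - h ^ 2) ≤ 1`
  have e : star ((2 : ℂ) • h - 1) * ((2 : ℂ) • h - 1) = 1 - (4 : ℝ) • (h ^ 1 - h ^ 2) := by
    rw [hs, ← Complex.coe_smul]
    simp only [sub_mul, mul_sub, smul_mul_smul_comm, mul_one, one_mul, smul_sub, pow_one, sq]
    push_cast
    module
  have h3 : ‖star ((2 : ℂ) • h - 1) * ((2 : ℂ) • h - 1)‖ ≤ 1 := by
    rw [CStarAlgebra.norm_le_one_iff_of_nonneg _ (star_mul_self_nonneg _), e]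
    exact sub_le_self _ (smul_nonneg (by norm_num) (sub_nonneg.2 hsq))
  rw [CStarRing.norm_star_mul_self, ← sq] at h3
  exact (sq_le_one_iff₀ (norm_nonneg _)).1 h3

/-- Since `h` has norm `1` in the normed space `A ⧸ J`, the Hahn–Banach theorem gives a contractive
functional that vanishes on `J` and is `1` at `h ≥ 0`; it is automatically `1` at the unit. -/
theorem nonempty_peakStates {J : Submodule ℂ A} {h : A} (h0 : 0 ≤ h) (h1 : ‖h‖ = 1)
    (hJ : ∀ j ∈ J, 1 ≤ ‖h - j‖) : (peakStates J h).Nonempty := by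
  have hq : ‖(Submodule.Quotient.mk h : A ⧸ J)‖ = 1 := by
    apply le_antisymm
    · rw [← h1]
      exact Submodule.Quotient.norm_mk_le J h
    · refine QuotientAddGroup.le_norm_iff.2 fun m hm => ?_
      have hmem : h - m ∈ J := (Submodule.Quotient.eq J).1 hm.symm
      simpa using hJ _ hmem
  obtain ⟨g, hg, hgh⟩ := exists_dual_vector ℂ (Submodule.Quotient.mk h : A ⧸ J)
    (by rw [hq]; exact one_ne_zero)
  let f : A →L[ℂ] ℂ := (g.toLinearMap ∘ₗ J.mkQ).mkContinuous 1 fun x => by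
    rw [one_mul]
    refine (g.le_opNorm _).trans ?_
    rw [hg, one_mul]
    exact Submodule.Quotient.norm_mk_le J x
  have hfx : ∀ x, f x = g (Submodule.Quotient.mk x) := fun x => rfl
  have hf : ‖f‖ ≤ 1 := LinearMap.mkContinuous_norm_le _ zero_le_one _
  have hfh : f h = 1 := by rw [hfx, hgh, hq]; rfl
  have hle : ∀ x, ‖x‖ ≤ 1 → ‖f x‖ ≤ 1 := fun x hx =>
    (f.le_opNorm x).trans (mul_le_one₀ hf (norm_nonneg x) hx)
  have hn1 : ‖(1 : A)‖ ≤ 1 := by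
    rcases subsingleton_or_nontrivial A with hA | hA
    · simp [Subsingleton.elim (1 : A) 0]
    · simp
  -- Both `‖f 1‖ ≤ 1` and `‖2 - f 1‖ ≤ 1`, which leaves only `f 1 = 1`.
  have hf1 : f 1 = 1 := by
    have i1 := hle 1 hn1
    have i2 := hle _ (norm_two_smul_sub_one_le h0 h1.le)
    rw [map_sub, map_smul, hfh, smul_eq_mul, mul_one] at i2
    have j1 : (f 1).re ≤ 1 := (Complex.re_le_norm _).trans i1
    have j2 := (Complex.re_le_norm _).trans i2
    simp only [Complex.sub_re, Complex.re_ofNat] at j2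
    have j3 : (f 1).re = 1 := by linarith
    have j4 : ‖f 1‖ ^ 2 ≤ 1 := (sq_le_one_iff₀ (norm_nonneg _)).2 i1
    rw [← Complex.normSq_eq_norm_sq, Complex.normSq_apply, j3] at j4
    have j5 : (f 1).im = 0 := by nlinarith
    exact Complex.ext j3 j5
  exact ⟨StrongDual.toWeakDual f, hf, hf1, fun j hj => by
    change f j = 0
    rw [hfx, (Submodule.Quotient.mk_eq_zero J).2 hj, map_zero], hfh⟩

end States

/-! ### Irreducible representations from extreme states -/

section VectorStates

variable {A : Type*} [CStarAlgebra A] {H : Type*} [NormedAddCommGroup H]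
  [InnerProductSpace ℂ H] [CompleteSpace H]

theorem norm_inner_apply_self_le (π : A →⋆ₐ[ℂ] (H →L[ℂ] H)) (v : H) (a : A) :
    ‖((‖v‖ : ℂ) ^ 2)⁻¹ * ⟪v, π a v⟫_ℂ‖ ≤ 1 * ‖a‖ := by
  have h1 : ‖⟪v, π a v⟫_ℂ‖ ≤ ‖a‖ * ‖v‖ ^ 2 := by
    calc ‖⟪v, π a v⟫_ℂ‖ ≤ ‖v‖ * ‖π a v‖ := norm_inner_le_norm _ _
      _ ≤ ‖v‖ * (‖a‖ * ‖v‖) := by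
          gcongr
          exact ((π a).le_opNorm v).trans
            (by gcongr; exact NonUnitalStarAlgHom.norm_apply_le π a)
      _ = ‖a‖ * ‖v‖ ^ 2 := by ring
  rw [one_mul, norm_mul, norm_inv, norm_pow, Complex.norm_real, norm_norm]
  rcases eq_or_ne ‖v‖ 0 with h0 | h0
  · simp [h0]
  · rw [inv_mul_le_iff₀ (by positivity)]
    linarith

/-- The normalised vector functional `a ↦ ⟪v, π a v⟫ / ‖v‖ ^ 2` of a representation `π`.
It is `0` for `v = 0`. -/
noncomputable def vectorState (π : A →⋆ₐ[ℂ] (H →L[ℂ] H)) (v : H) : A →L[ℂ] ℂ :=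
  LinearMap.mkContinuous
    { toFun := fun a => ((‖v‖ : ℂ) ^ 2)⁻¹ * ⟪v, π a v⟫_ℂ
      map_add' := fun a b => by simp [mul_add]
      map_smul' := fun c a => by simp; ring }
    1 (norm_inner_apply_self_le π v)

theorem vectorState_apply (π : A →⋆ₐ[ℂ] (H →L[ℂ] H)) (v : H) (a : A) :
    vectorState π v a = ((‖v‖ : ℂ) ^ 2)⁻¹ * ⟪v, π a v⟫_ℂ := rfl

theorem vectorState_mem_peakStates {π : A →⋆ₐ[ℂ] (H →L[ℂ] H)} {J : Submodule ℂ A} {h : A}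
    (hπ : ∀ j ∈ J, π j = 0) {v : H} (hv : v ≠ 0) (hh : π h v = v) :
    StrongDual.toWeakDual (vectorState π v) ∈ peakStates J h := by
  have hv' : ((‖v‖ : ℂ) ^ 2) ≠ 0 := by simpa using hv
  refine ⟨LinearMap.mkContinuous_norm_le _ zero_le_one (norm_inner_apply_self_le π v), ?_,
    fun j hj => ?_, ?_⟩
  · change vectorState π v 1 = 1
    rw [vectorState_apply, map_one, one_apply_eq_self, inner_self_eq_norm_sq_to_K]
    exact inv_mul_cancel₀ hv'
  · change vectorState π v j = 0
    simp [vectorState_apply, hπ j hj]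
  · change vectorState π v h = 1
    rw [vectorState_apply, hh, inner_self_eq_norm_sq_to_K]
    exact inv_mul_cancel₀ hv'

theorem eq_zero_of_inner_cyclic {π : A →⋆ₐ[ℂ] (H →L[ℂ] H)} {ξ : H}
    (hξ : DenseRange fun a => π a ξ) {x : H} (hx : ∀ a, ⟪x, π a ξ⟫_ℂ = 0) : x = 0 := by
  refine Dense.eq_zero_of_inner_left (𝕜 := ℂ) (S := Set.range fun a => π a ξ) hξ ?_
  rintro _ ⟨a, rfl⟩
  exact hx a

theorem apply_eq_zero_of_mem_ideal {π : A →⋆ₐ[ℂ] (H →L[ℂ] H)} {ξ : H}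
    (hξ : DenseRange fun a => π a ξ) {J : Submodule ℂ A}
    (hl : ∀ a, ∀ j ∈ J, a * j ∈ J) (hr : ∀ a, ∀ j ∈ J, j * a ∈ J)
    (hJ : ∀ j ∈ J, ⟪ξ, π j ξ⟫_ℂ = 0) {j : A} (hj : j ∈ J) : π j = 0 := by
  have h1 : ∀ b, π j (π b ξ) = 0 := by
    intro b
    refine eq_zero_of_inner_cyclic hξ fun a => ?_
    rw [← inner_conj_symm]
    have e : ⟪π a ξ, π j (π b ξ)⟫_ℂ = ⟪ξ, π (star a * (j * b)) ξ⟫_ℂ := by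
      rw [map_mul, map_mul, map_star, mul_apply_eq_comp, mul_apply_eq_comp,
        ContinuousLinearMap.star_eq_adjoint, ContinuousLinearMap.adjoint_inner_right]
    rw [e, hJ _ (hl _ _ (hr _ _ hj)), map_zero]
  ext x
  have := hξ.equalizer (π j).continuous (continuous_const (y := (0 : H))) (funext h1)
  exact congrFun this x

/-- The equality case of the Cauchy–Schwarz inequality. -/
theorem apply_eq_self_of_inner_eq_one {π : A →⋆ₐ[ℂ] (H →L[ℂ] H)} {ξ : H} (hξ : ‖ξ‖ = 1)
    {h : A} (h1 : ‖h‖ ≤ 1) (hh : ⟪ξ, π h ξ⟫_ℂ = 1) : π h ξ = ξ := by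
  have h2 : ‖π h ξ‖ ≤ 1 := by
    refine ((π h).le_opNorm ξ).trans ?_
    rw [hξ, mul_one]
    exact (NonUnitalStarAlgHom.norm_apply_le π h).trans h1
  have h3 := norm_sub_sq (𝕜 := ℂ) ξ (π h ξ)
  rw [hh, hξ] at h3
  have h4 : ‖ξ - π h ξ‖ ^ 2 ≤ 0 := by
    rw [h3]
    have : ‖π h ξ‖ ^ 2 ≤ 1 := (sq_le_one_iff₀ (norm_nonneg _)).2 h2
    have h1' : RCLike.re (1 : ℂ) = 1 := Complex.one_re
    rw [h1']
    linarith
  have h5 : ‖ξ - π h ξ‖ = 0 := by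
    have := sq_nonneg ‖ξ - π h ξ‖
    exact pow_eq_zero_iff two_ne_zero |>.1 (le_antisymm h4 this)
  exact (sub_eq_zero.1 (norm_eq_zero.1 h5)).symm

/-- The orthogonal projection onto a closed invariant subspace commutes with the representation. -/
theorem starProjection_apply_comm {π : A →⋆ₐ[ℂ] (H →L[ℂ] H)} {K : Submodule ℂ H}
    [K.HasOrthogonalProjection] (hK : ∀ a, ∀ x ∈ K, π a x ∈ K) (a : A) (x : H) :
    K.starProjection (π a x) = π a (K.starProjection x) := by
  refine Submodule.eq_starProjection_of_mem_of_inner_eq_zero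
    (hK a _ (Submodule.starProjection_apply_mem K x)) fun w hw => ?_
  rw [← map_sub, ← ContinuousLinearMap.adjoint_inner_right, ← ContinuousLinearMap.star_eq_adjoint,
    ← map_star]
  exact Submodule.starProjection_inner_eq_zero _ _ (hK _ _ hw)

/-- A cyclic representation is irreducible if its vector state is extreme among the states which
annihilate a fixed ideal and peak at a fixed element: a closed invariant subspace splits the cyclic
vector into two vectors whose states are again of this kind. -/
theorem eq_bot_or_eq_top_of_mem_extremePoints {π : A →⋆ₐ[ℂ] (H →L[ℂ] H)} {ξ : H} (hn : ‖ξ‖ = 1)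
    (hξ : DenseRange fun a => π a ξ) {J : Submodule ℂ A} {h : A} (hπ : ∀ j ∈ J, π j = 0)
    (hh : π h ξ = ξ)
    (hext : StrongDual.toWeakDual (vectorState π ξ) ∈ (peakStates J h).extremePoints ℝ)
    {K : Submodule ℂ H} (hc : IsClosed (K : Set H)) (hK : ∀ a, ∀ x ∈ K, π a x ∈ K) :
    K = ⊥ ∨ K = ⊤ := by
  have : CompleteSpace K := hc.completeSpace_coe
  have hcomm := starProjection_apply_comm hK
  set η := K.starProjection ξ with hη
  have horth : ∀ a, ⟪ξ - η, π a η⟫_ℂ = 0 := fun a =>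
    Submodule.starProjection_inner_eq_zero _ _ (hK a _ (Submodule.starProjection_apply_mem K ξ))
  have hηin : ∀ a, ⟪η, π a ξ⟫_ℂ = ⟪η, π a η⟫_ℂ := by
    intro a
    rw [hη, ← hcomm, Submodule.inner_starProjection_left_eq_right,
      Submodule.inner_starProjection_left_eq_right, Submodule.starProjection_eq_self_iff.2
        (Submodule.starProjection_apply_mem K _)]
  have hηn : (‖η‖ : ℂ) ^ 2 = ⟪η, η⟫_ℂ := (inner_self_eq_norm_sq_to_K η).symm
  by_cases h0 : η = 0
  · left
    rw [eq_bot_iff]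
    intro x hx
    have hz := hξ.equalizer (K.starProjection.continuous) (continuous_const (y := (0 : H)))
      (funext fun a => by simp [hcomm, ← hη, h0])
    have := congrFun hz x
    rwa [Submodule.starProjection_eq_self_iff.2 hx] at this
  by_cases h1 : ξ - η = 0
  · right
    rw [eq_top_iff]
    intro x _
    have hz := hξ.equalizer (K.starProjection.continuous) continuous_id
      (funext fun a => by simp [hcomm, ← hη, ← sub_eq_zero.1 h1])
    exact Submodule.starProjection_eq_self_iff.1 (congrFun hz x)
  exfalso
  have hhη : π h η = η := by rw [hη, ← hcomm, hh]
  have hhζ : π h (ξ - η) = ξ - η := by rw [map_sub, hh, hhη]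
  have m1 := vectorState_mem_peakStates hπ h0 hhη
  have m2 := vectorState_mem_peakStates hπ h1 hhζ
  have hpyth : ‖η‖ ^ 2 + ‖ξ - η‖ ^ 2 = 1 := by
    have h3 := norm_add_sq (𝕜 := ℂ) (ξ - η) η
    have h4 := horth 1
    rw [map_one, one_apply_eq_self] at h4
    rw [sub_add_cancel, hn, h4] at h3
    simp only [map_zero] at h3
    linarith
  have hp1 : 0 < ‖η‖ ^ 2 := by positivity
  have hp2 : 0 < ‖ξ - η‖ ^ 2 := by positivity
  have hseg : StrongDual.toWeakDual (vectorState π ξ) ∈ openSegment ℝ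
      (StrongDual.toWeakDual (vectorState π η))
      (StrongDual.toWeakDual (vectorState π (ξ - η))) := by
    refine ⟨‖η‖ ^ 2, ‖ξ - η‖ ^ 2, hp1, hp2, hpyth, ?_⟩
    refine DFunLike.ext _ _ fun a => ?_
    change ((‖η‖ ^ 2 : ℝ)) • vectorState π η a + (‖ξ - η‖ ^ 2 : ℝ) • vectorState π (ξ - η) a =
      vectorState π ξ a
    have hz1 : (‖η‖ : ℂ) ≠ 0 := by simpa using h0
    have hz2 : (‖ξ - η‖ : ℂ) ≠ 0 := by exact_mod_cast norm_ne_zero_iff.2 h1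
    simp only [vectorState_apply, Complex.real_smul, hn]
    push_cast
    rw [mul_inv_cancel_left₀ (pow_ne_zero 2 hz1), mul_inv_cancel_left₀ (pow_ne_zero 2 hz2),
      map_sub, inner_sub_right, horth, inner_sub_left, hηin]
    simp
  have heq := ((mem_extremePoints.1 hext).2 _ m1 _ m2 hseg).1
  have hval : ∀ a, ((‖η‖ : ℂ) ^ 2)⁻¹ * ⟪η, π a η⟫_ℂ = ⟪ξ, π a ξ⟫_ℂ := by
    intro a
    have h3 : vectorState π η a = vectorState π ξ a := DFunLike.congr_fun heq a
    rw [vectorState_apply, vectorState_apply, hn] at h3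
    simpa using h3
  -- Extremality gives `⟪η, π a ξ⟫ = ‖η‖ ^ 2 ⟪ξ, π a ξ⟫` for all `a`, so `η` is a multiple of `ξ`.
  have hz : η - ((‖η‖ : ℂ) ^ 2) • ξ = 0 := by
    refine eq_zero_of_inner_cyclic hξ fun a => ?_
    have hz1 : (‖η‖ : ℂ) ≠ 0 := by simpa using h0
    rw [inner_sub_left, inner_smul_left, ← hval, hηin]
    simp only [map_pow, Complex.conj_ofReal]
    rw [mul_inv_cancel_left₀ (pow_ne_zero 2 hz1), sub_self]
  have hmem : ξ ∈ K := by
    have h3 : ((‖η‖ : ℂ) ^ 2) • ξ ∈ K := by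
      rw [← sub_eq_zero.1 hz]
      exact Submodule.starProjection_apply_mem K ξ
    exact (Submodule.smul_mem_iff K (pow_ne_zero 2 (by simpa using h0))).1 h3
  exact h1 (by rw [hη, Submodule.starProjection_eq_self_iff.2 hmem, sub_self])

end VectorStates

/-- Let `J` be a two-sided ideal and `h ≥ 0` an element of norm `1` whose distance from `J` is `1`.
Some irreducible representation kills `J` and has a unit vector fixed by `h`. -/
theorem exists_irreducible_of_le_norm_sub {A : Type u} [CStarAlgebra A] [PartialOrder A]
    [StarOrderedRing A] {J : Submodule ℂ A} (hl : ∀ a, ∀ j ∈ J, a * j ∈ J)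
    (hr : ∀ a, ∀ j ∈ J, j * a ∈ J) {h : A} (h0 : 0 ≤ h) (h1 : ‖h‖ = 1)
    (hJ : ∀ j ∈ J, 1 ≤ ‖h - j‖) :
    ∃ (H : Type u) (_ : NormedAddCommGroup H) (_ : InnerProductSpace ℂ H) (_ : CompleteSpace H)
      (π : A →⋆ₐ[ℂ] (H →L[ℂ] H)),
      (∀ K : Submodule ℂ H, IsClosed (K : Set H) → (∀ a, ∀ x ∈ K, π a x ∈ K) → K = ⊥ ∨ K = ⊤) ∧
      (∀ j ∈ J, π j = 0) ∧ ∃ ξ : H, ‖ξ‖ = 1 ∧ π h ξ = ξ := by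
  have := WeakDual.locallyConvexSpace_real A
  obtain ⟨φ, hφ⟩ := (isCompact_peakStates J h).extremePoints_nonempty (nonempty_peakStates h0 h1 hJ)
  obtain ⟨hφn, hφ1, hφJ, hφh⟩ := hφ.1
  let f : A →ₚ[ℂ] ℂ := PositiveLinearMap.mk₀ (φ : A →ₗ[ℂ] ℂ)
    fun a ha => apply_nonneg_of_norm_le_one (f := WeakDual.toStrongDual φ) hφn hφ1 ha
  have hf : ∀ a, f a = φ a := fun a => rfl
  -- The cyclic vector of the GNS representation is the class of the unit.
  let ξ : f.GNS := ((f.toPreGNS 1 : f.PreGNS) : f.GNS)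
  have hπξ : ∀ a, f.gnsStarAlgHom a ξ = ((f.toPreGNS a : f.PreGNS) : f.GNS) := by
    intro a
    simp [ξ]
  have hin : ∀ a, ⟪ξ, f.gnsStarAlgHom a ξ⟫_ℂ = φ a := by
    intro a
    rw [hπξ, UniformSpace.Completion.inner_coe, PositiveLinearMap.preGNS_inner_def]
    simp [hf]
  have hn : ‖ξ‖ = 1 := by
    have h2 := hin 1
    rw [map_one, one_apply_eq_self, inner_self_eq_norm_sq_to_K, hφ1] at h2
    have h3 : ((‖ξ‖ ^ 2 : ℝ) : ℂ) = 1 := by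
      rw [Complex.ofReal_pow]
      exact h2
    exact (pow_eq_one_iff_of_nonneg (norm_nonneg ξ) two_ne_zero).1 (Complex.ofReal_eq_one.1 h3)
  have hdense : DenseRange fun a => f.gnsStarAlgHom a ξ := by
    have h2 : DenseRange (fun x : f.PreGNS => (x : f.GNS)) :=
      UniformSpace.Completion.denseRange_coe
    have h3 : (fun a => f.gnsStarAlgHom a ξ) = (fun x : f.PreGNS => (x : f.GNS)) ∘ f.toPreGNS :=
      funext hπξ
    rw [h3]
    exact h2.comp f.toPreGNS.surjective.denseRange (UniformSpace.Completion.continuous_coe _)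
  have hπJ : ∀ j ∈ J, f.gnsStarAlgHom j = 0 := fun j hj =>
    apply_eq_zero_of_mem_ideal hdense hl hr (fun j hj => by rw [hin, hφJ j hj]) hj
  have hπh : f.gnsStarAlgHom h ξ = ξ :=
    apply_eq_self_of_inner_eq_one hn h1.le (by rw [hin, hφh])
  have hvs : StrongDual.toWeakDual (vectorState f.gnsStarAlgHom ξ) = φ := by
    refine DFunLike.ext _ _ fun a => ?_
    change vectorState f.gnsStarAlgHom ξ a = φ a
    rw [vectorState_apply, hn, hin]
    simp
  refine ⟨f.GNS, inferInstance, inferInstance, inferInstance, f.gnsStarAlgHom, ?_, hπJ,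
    ξ, hn, hπh⟩
  intro K hc hK
  exact eq_bot_or_eq_top_of_mem_extremePoints hn hdense hπJ hπh (by rwa [hvs]) hc hK

/-! ### Normal operators and limits of nilpotent operators -/

section Dilation

open Filter Topology

variable {H : Type*} [NormedAddCommGroup H] [InnerProductSpace ℂ H]

/-- An operator `T` with `‖T v‖ = ‖v‖` on a subspace `E` and `‖T v‖ ≤ s ‖v‖`, `s < 1`, on its
orthogonal complement, both being invariant, is not a limit of nilpotent operators: an operator
near `T` maps the cone of vectors whose `E`-component dominates into itself, and kills no nonzero
vector of it. -/
theorem notMem_closure_isNilpotent_of_reduces {T : H →L[ℂ] H} {E : Submodule ℂ H}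
    [E.HasOrthogonalProjection] (hcomm : ∀ x, E.starProjection (T x) = T (E.starProjection x))
    (hE : ∀ x ∈ E, ‖T x‖ = ‖x‖) {s : ℝ} (hs0 : 0 ≤ s) (hs : s < 1)
    (hs' : ∀ x ∈ Eᗮ, ‖T x‖ ≤ s * ‖x‖)
    {ξ : H} (hξE : ξ ∈ E) (hξ : ξ ≠ 0) :
    T ∉ closure {N : H →L[ℂ] H | IsNilpotent N} := by
  intro hT
  obtain ⟨N, ⟨n, hn⟩, hN⟩ := Metric.mem_closure_iff.1 hT ((1 - s) / 8) (by linarith)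
  rw [dist_eq_norm] at hN
  set ε := (1 - s) / 8 with hε
  set P := E.starProjection with hP
  have hPle : ∀ y, ‖P y‖ ≤ ‖y‖ := fun y => E.norm_starProjection_apply_le y
  have hQle : ∀ y, ‖y - P y‖ ≤ ‖y‖ := fun y => by
    rw [hP, ← Submodule.starProjection_orthogonal_val]
    exact Eᗮ.norm_starProjection_apply_le y
  -- `N` maps the nonzero vectors of the cone `‖x - P x‖ ≤ ‖P x‖` to nonzero vectors of the cone.
  have hstep : ∀ x, ‖x - P x‖ ≤ ‖P x‖ → P x ≠ 0 →
      ‖N x - P (N x)‖ ≤ ‖P (N x)‖ ∧ P (N x) ≠ 0 := by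
    intro x hx hx0
    have hp : 0 < ‖P x‖ := norm_pos_iff.2 hx0
    have hxn : ‖x‖ ≤ 2 * ‖P x‖ := by
      calc ‖x‖ = ‖P x + (x - P x)‖ := by rw [add_sub_cancel]
        _ ≤ ‖P x‖ + ‖x - P x‖ := norm_add_le _ _
        _ ≤ 2 * ‖P x‖ := by linarith
    set d := T x - N x with hd
    have hdn : ‖d‖ ≤ 2 * ε * ‖P x‖ := by
      have h1 : ‖d‖ ≤ ‖T - N‖ * ‖x‖ := (T - N).le_opNorm x
      have h2 : ‖T - N‖ * ‖x‖ ≤ ε * (2 * ‖P x‖) := by gcongr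
      linarith
    have hPN : P (N x) = T (P x) - P d := by
      rw [hd, map_sub, hcomm]
      abel
    have hQN : N x - P (N x) = T (x - P x) - (d - P d) := by
      rw [hPN, hd, map_sub, map_sub]
      abel
    have i1 : ‖P x‖ - 2 * ε * ‖P x‖ ≤ ‖P (N x)‖ := by
      have h1 : ‖T (P x)‖ = ‖P x‖ := hE _ (E.starProjection_apply_mem x)
      have h2 := norm_sub_norm_le (T (P x)) (P d)
      rw [← hPN, h1] at h2
      linarith [hPle d]
    have i2 : ‖N x - P (N x)‖ ≤ s * ‖x - P x‖ + 2 * ε * ‖P x‖ := by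
      have h1 : ‖T (x - P x)‖ ≤ s * ‖x - P x‖ :=
        hs' _ (E.sub_starProjection_mem_orthogonal x)
      have h2 := norm_sub_le (T (x - P x)) (d - P d)
      rw [← hQN] at h2
      linarith [hQle d]
    have i3 : s * ‖x - P x‖ ≤ s * ‖P x‖ := mul_le_mul_of_nonneg_left hx hs0
    have i4 : 8 * (ε * ‖P x‖) = (1 - s) * ‖P x‖ := by rw [hε]; ring
    have i5 : 0 ≤ s * ‖P x‖ := by positivity
    have i6 : 0 < (1 - s) * ‖P x‖ := mul_pos (by linarith) hp
    exact ⟨by linarith, norm_pos_iff.1 (by linarith)⟩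
  have hiter : ∀ m, ‖(N ^ m) ξ - P ((N ^ m) ξ)‖ ≤ ‖P ((N ^ m) ξ)‖ ∧ P ((N ^ m) ξ) ≠ 0 := by
    intro m
    induction m with
    | zero =>
      have : P ξ = ξ := Submodule.starProjection_eq_self_iff.2 hξE
      simp [this, hξ]
    | succ m ih =>
      rw [pow_succ', mul_apply_eq_comp]
      exact hstep _ ih.1 ih.2
  exact (hiter n).2 (by rw [hn]; simp)

variable [CompleteSpace H]

/-- If `S = T⋆T` with `‖T‖ ≤ 1` is at distance less than `1` from a compact operator, then `T` has
norm less than `1` on the orthogonal complement of the space of fixed vectors of `S`: otherwise a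
sequence of unit vectors `x n` there with `S (x n) - x n → 0` has a convergent subsequence, whose
limit is fixed by `S`. -/
theorem exists_lt_one_of_norm_sub_isCompactOperator_lt_one {T k : H →L[ℂ] H} (hT : ‖T‖ ≤ 1)
    (hk : IsCompactOperator k) (hTk : ‖star T * T - k‖ < 1) {E : Submodule ℂ H}
    (hE : ∀ x, x ∈ E ↔ (star T * T) x = x) :
    ∃ s < 1, ∀ x ∈ Eᗮ, ‖T x‖ ≤ s * ‖x‖ := by
  by_contra! hcon
  set S := star T * T with hS
  have hTle : ∀ x, ‖T x‖ ≤ ‖x‖ := fun x => T.le_of_opNorm_le_of_le hT le_rfl |>.trans (by simp)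
  have hSle : ∀ x, ‖S x‖ ≤ ‖x‖ := fun x => by
    have : ‖S‖ ≤ 1 := by
      rw [hS, CStarRing.norm_star_mul_self]
      exact mul_le_one₀ hT (norm_nonneg _) hT
    exact (S.le_of_opNorm_le_of_le this le_rfl).trans (by simp)
  have hdefect : ∀ x, ‖S x - x‖ ^ 2 ≤ 2 * (‖x‖ ^ 2 - ‖T x‖ ^ 2) := by
    intro x
    have h1 := norm_sub_sq (𝕜 := ℂ) (S x) x
    have h2 : ⟪S x, x⟫_ℂ = (‖T x‖ : ℂ) ^ 2 := by
      rw [hS, mul_apply_eq_comp, ContinuousLinearMap.star_eq_adjoint,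
        ContinuousLinearMap.adjoint_inner_left, inner_self_eq_norm_sq_to_K]
      rfl
    have h3 : RCLike.re ((‖T x‖ : ℂ) ^ 2) = ‖T x‖ ^ 2 := by
      rw [← Complex.ofReal_pow]
      exact Complex.ofReal_re _
    rw [h2, h3] at h1
    have h4 : ‖S x‖ ^ 2 ≤ ‖x‖ ^ 2 := by gcongr; exact hSle x
    linarith
  have hseq : ∀ n : ℕ, ∃ x ∈ Eᗮ, ‖x‖ = 1 ∧ 1 - 1 / ((n : ℝ) + 1) ≤ ‖T x‖ := by
    intro n
    obtain ⟨x, hx, hlt⟩ := hcon (1 - 1 / ((n : ℝ) + 1)) (by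
      have : 0 < 1 / ((n : ℝ) + 1) := by positivity
      linarith)
    have hx0 : x ≠ 0 := by
      rintro rfl
      simp at hlt
    have hpos : 0 < ‖x‖ := norm_pos_iff.2 hx0
    refine ⟨((‖x‖ : ℂ)⁻¹) • x, Eᗮ.smul_mem _ hx, ?_, ?_⟩
    · rw [norm_smul, norm_inv, Complex.norm_real, norm_norm, inv_mul_cancel₀ hpos.ne']
    · rw [map_smul, norm_smul, norm_inv, Complex.norm_real, norm_norm, le_inv_mul_iff₀ hpos]
      linarith
  choose x hxE hx1 hxT using hseq
  have hlim : Tendsto (fun n => S (x n) - x n) atTop (𝓝 0) := by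
    have hb : ∀ n, ‖S (x n) - x n‖ ≤ Real.sqrt (4 * (1 / ((n : ℝ) + 1))) := by
      intro n
      apply Real.le_sqrt_of_sq_le
      refine (hdefect _).trans ?_
      rw [hx1]
      have h1 := hxT n
      have h2 : ‖T (x n)‖ ≤ 1 := (hTle _).trans (hx1 n).le
      have h3 : 0 ≤ ‖T (x n)‖ := norm_nonneg _
      nlinarith
    refine squeeze_zero_norm hb ?_
    have h1 := (tendsto_one_div_add_atTop_nhds_zero_nat (𝕜 := ℝ)).const_mul 4
    have h2 := (Real.continuous_sqrt.tendsto _).comp h1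
    rw [mul_zero, Real.sqrt_zero] at h2
    exact h2
  -- Along a subsequence `k (x n)` converges, and `1 - (S - k)` is invertible.
  have hcpt := hk.isCompact_closure_image_closedBall (f := (k : H →ₗ[ℂ] H)) 1
  obtain ⟨y, -, φ, hφ, hy⟩ := hcpt.tendsto_subseq (x := fun n => k (x n))
    (fun n => subset_closure ⟨x n, by simp [hx1], rfl⟩)
  obtain ⟨u, hu⟩ : IsUnit (1 - (S - k)) := ⟨Units.oneSub (S - k) hTk, rfl⟩
  have hconv : Tendsto (fun n => x (φ n)) atTop (𝓝 ((↑u⁻¹ : H →L[ℂ] H) y)) := by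
    have h1 : Tendsto (fun n => k (x (φ n)) - (S (x (φ n)) - x (φ n))) atTop (𝓝 (y - 0)) :=
      hy.sub (hlim.comp hφ.tendsto_atTop)
    rw [sub_zero] at h1
    have h2 := ((↑u⁻¹ : H →L[ℂ] H).continuous.tendsto y).comp h1
    refine h2.congr fun n => ?_
    have h3 : k (x (φ n)) - (S (x (φ n)) - x (φ n)) = (u : H →L[ℂ] H) (x (φ n)) := by
      rw [hu]
      simp
      abel
    rw [Function.comp_apply, h3, ← mul_apply_eq_comp, Units.inv_mul,
      one_apply_eq_self]
  set z := (↑u⁻¹ : H →L[ℂ] H) y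
  have hz1 : ‖z‖ = 1 := tendsto_nhds_unique hconv.norm (by simp [hx1])
  have hzorth : z ∈ Eᗮ := E.isClosed_orthogonal.mem_of_tendsto hconv (.of_forall fun n => hxE _)
  have hzE : z ∈ E := by
    rw [hE, ← sub_eq_zero]
    exact tendsto_nhds_unique (((S.continuous.tendsto z).comp hconv).sub hconv)
      (hlim.comp hφ.tendsto_atTop)
  have hz0 : z = 0 := by
    have := E.inner_right_of_mem_orthogonal hzE hzorth
    exact inner_self_eq_zero.1 this
  simp [hz0] at hz1

/-- A normal contraction `T` for which `T⋆T` fixes a nonzero vector and is at distance less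
than `1` from a compact operator is not a norm limit of nilpotent operators. -/
theorem notMem_closure_isNilpotent {T k : H →L[ℂ] H} [hTn : IsStarNormal T] (hT : ‖T‖ ≤ 1)
    (hk : IsCompactOperator k) (hTk : ‖star T * T - k‖ < 1) {ξ : H} (hξ : ξ ≠ 0)
    (hfix : (star T * T) ξ = ξ) : T ∉ closure {N : H →L[ℂ] H | IsNilpotent N} := by
  let E : Submodule ℂ H := LinearMap.ker ((star T * T - 1 : H →L[ℂ] H) : H →ₗ[ℂ] H)
  have hE : ∀ x, x ∈ E ↔ (star T * T) x = x := by
    intro x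
    simp [E, LinearMap.mem_ker, sub_eq_zero]
  have hEc : IsClosed (E : Set H) := (star T * T - 1 : H →L[ℂ] H).isClosed_ker
  have : CompleteSpace E := hEc.completeSpace_coe
  have hc1 : Commute (star T * T) T := by
    have h1 : Commute (star T) T := hTn.star_comm_self
    exact h1.mul_left (Commute.refl T)
  have hc2 : Commute (star T * T) (star T) := by
    have h1 : Commute (star T) T := hTn.star_comm_self
    exact (Commute.refl (star T)).mul_left h1.symm
  have hinv : ∀ R : H →L[ℂ] H, Commute (star T * T) R → ∀ x ∈ E, R x ∈ E := by
    intro R hR x hx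
    rw [hE] at hx ⊢
    rw [← mul_apply_eq_comp, hR.eq, mul_apply_eq_comp, hx]
  have hcomm : ∀ x, E.starProjection (T x) = T (E.starProjection x) := by
    intro x
    refine Submodule.eq_starProjection_of_mem_of_inner_eq_zero
      (hinv T hc1 _ (E.starProjection_apply_mem x)) fun w hw => ?_
    rw [← map_sub, ← ContinuousLinearMap.adjoint_inner_right,
      ← ContinuousLinearMap.star_eq_adjoint]
    exact Submodule.starProjection_inner_eq_zero _ _ (hinv _ hc2 _ hw)
  have hiso : ∀ x ∈ E, ‖T x‖ = ‖x‖ := by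
    intro x hx
    have h1 : ⟪T x, T x⟫_ℂ = ⟪x, x⟫_ℂ := by
      rw [← ContinuousLinearMap.adjoint_inner_left, ← ContinuousLinearMap.star_eq_adjoint,
        ← mul_apply_eq_comp, (hE x).1 hx]
    rw [inner_self_eq_norm_sq_to_K, inner_self_eq_norm_sq_to_K] at h1
    have h2 : ‖T x‖ ^ 2 = ‖x‖ ^ 2 := by exact_mod_cast h1
    exact (sq_eq_sq₀ (norm_nonneg _) (norm_nonneg _)).1 h2
  obtain ⟨s, hs, hs'⟩ := exists_lt_one_of_norm_sub_isCompactOperator_lt_one hT hk hTk hE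
  exact notMem_closure_isNilpotent_of_reduces hcomm hiso (le_max_right s 0)
    (max_lt hs zero_lt_one) (fun x hx => (hs' x hx).trans
      (mul_le_mul_of_nonneg_right (le_max_left s 0) (norm_nonneg x))) ((hE ξ).2 hfix) hξ

end Dilation

/-! ### Nilpotent elements under homomorphisms -/

section Nilpotent

theorem IsNilpotentElement.map {A B F : Type*} [NonUnitalRing A] [NonUnitalRing B]
    [FunLike F A B] [NonUnitalRingHomClass F A B] (φ : F) {a : A} (ha : IsNilpotentElement a) :
    IsNilpotentElement (φ a) := by
  have key : ∀ n, nonUnitalPow (φ a) n = φ (nonUnitalPow a n) := by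
    intro n
    induction n with
    | zero => rfl
    | succ n ih => rw [nonUnitalPow, nonUnitalPow, ih, map_mul]
  obtain ⟨n, hn⟩ := ha
  exact ⟨n, by rw [key, hn, map_zero]⟩

theorem IsNilpotentElement.smul {A : Type*} [NonUnitalRing A] [Module ℂ A]
    [IsScalarTower ℂ A A] [SMulCommClass ℂ A A] (c : ℂ) {a : A} (ha : IsNilpotentElement a) :
    IsNilpotentElement (c • a) := by
  have key : ∀ n, nonUnitalPow (c • a) n = c ^ (n + 1) • nonUnitalPow a n := by
    intro n
    induction n with
    | zero => simp [nonUnitalPow]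
    | succ n ih => rw [nonUnitalPow, nonUnitalPow, ih, smul_mul_smul_comm, ← pow_succ]
  obtain ⟨n, hn⟩ := ha
  exact ⟨n, by rw [key, hn, smul_zero]⟩

theorem NonUnitalStarAlgHom.continuous_of_cstar {A B : Type*} [NonUnitalCStarAlgebra A]
    [NonUnitalCStarAlgebra B] (φ : A →⋆ₙₐ[ℂ] B) : Continuous φ :=
  AddMonoidHomClass.continuous_of_bound φ 1 fun a => by
    rw [one_mul]
    exact NonUnitalStarAlgHom.norm_apply_le φ a

theorem map_mem_closure_isNilpotentElement {A B : Type*} [NonUnitalCStarAlgebra A]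
    [NonUnitalCStarAlgebra B] (φ : A →⋆ₙₐ[ℂ] B) {a : A}
    (ha : a ∈ closure {b : A | IsNilpotentElement b}) :
    φ a ∈ closure {b : B | IsNilpotentElement b} :=
  map_mem_closure φ.continuous_of_cstar ha fun _ hb => IsNilpotentElement.map φ hb

end Nilpotent

/-! ### Type I algebras -/

section TypeI

variable {B : Type u} [NonUnitalCStarAlgebra B]

/-- The two-sided ideals, not necessarily closed, whose distance from `h` is at least `1`. -/
def idealsFarFrom (h : B) : Set (Submodule ℂ B) :=
  {J | (∀ a, ∀ j ∈ J, a * j ∈ J) ∧ (∀ a, ∀ j ∈ J, j * a ∈ J) ∧ ∀ j ∈ J, 1 ≤ ‖h - j‖}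

theorem exists_maximal_idealsFarFrom {h : B} (h1 : ‖h‖ = 1) :
    ∃ J, Maximal (· ∈ idealsFarFrom h) J := by
  have hbot : (⊥ : Submodule ℂ B) ∈ idealsFarFrom h := by
    refine ⟨?_, ?_, ?_⟩
    · rintro a j hj
      simp [(Submodule.mem_bot ℂ).1 hj]
    · rintro a j hj
      simp [(Submodule.mem_bot ℂ).1 hj]
    · rintro j hj
      simp [(Submodule.mem_bot ℂ).1 hj, h1]
  obtain ⟨J, -, hJ⟩ := zorn_le_nonempty₀ (idealsFarFrom h) (fun c hc hchain y hy => by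
    have hmem : ∀ z, z ∈ sSup c ↔ ∃ I ∈ c, z ∈ I := fun z =>
      Submodule.mem_sSup_of_directed ⟨y, hy⟩ hchain.directedOn
    refine ⟨sSup c, ⟨?_, ?_, ?_⟩, fun z hz => le_sSup hz⟩
    · intro a j hj
      obtain ⟨I, hI, hjI⟩ := (hmem j).1 hj
      exact (hmem _).2 ⟨I, hI, (hc hI).1 a j hjI⟩
    · intro a j hj
      obtain ⟨I, hI, hjI⟩ := (hmem j).1 hj
      exact (hmem _).2 ⟨I, hI, (hc hI).2.1 a j hjI⟩
    · intro j hj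
      obtain ⟨I, hI, hjI⟩ := (hmem j).1 hj
      exact (hc hI).2.2 j hjI) ⊥ hbot
  exact ⟨J, hJ⟩

/-- The preimage of the compact operators under a representation, as a subspace. -/
def compactPreimage {H : Type*} [NormedAddCommGroup H] [InnerProductSpace ℂ H] [CompleteSpace H]
    (π : B →⋆ₙₐ[ℂ] (H →L[ℂ] H)) : Submodule ℂ B where
  carrier := {c | IsCompactOperator (π c)}
  add_mem' {a b} ha hb := by
    have : IsCompactOperator (π a + π b : H →L[ℂ] H) := ha.add hb
    simpa only [Set.mem_ofPred_eq, map_add] using this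
  zero_mem' := by
    have : IsCompactOperator (0 : H →L[ℂ] H) := isCompactOperator_zero
    simpa only [Set.mem_ofPred_eq, map_zero] using this
  smul_mem' c a ha := by
    have : IsCompactOperator (c • π a : H →L[ℂ] H) := ha.smul c
    simpa only [Set.mem_ofPred_eq, map_smul] using this

theorem mem_compactPreimage {H : Type*} [NormedAddCommGroup H] [InnerProductSpace ℂ H]
    [CompleteSpace H] {π : B →⋆ₙₐ[ℂ] (H →L[ℂ] H)} {c : B} :
    c ∈ compactPreimage π ↔ IsCompactOperator (π c) := Iff.rfl

/-- The nonunital form of `exists_irreducible_of_le_norm_sub`, obtained in the unitization. -/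
theorem exists_isIrreducibleRep {J : Submodule ℂ B} {b : B} (hb : ‖star b * b‖ = 1)
    (hJ : J ∈ idealsFarFrom (star b * b)) :
    ∃ (H : Type u) (_ : NormedAddCommGroup H) (_ : InnerProductSpace ℂ H) (_ : CompleteSpace H)
      (π : B →⋆ₙₐ[ℂ] (H →L[ℂ] H)), IsIrreducibleRep π ∧ (∀ j ∈ J, π j = 0) ∧
        ∃ ξ : H, ‖ξ‖ = 1 ∧ π (star b * b) ξ = ξ := by
  let _ : PartialOrder (Unitization ℂ B) := CStarAlgebra.spectralOrder _
  have : StarOrderedRing (Unitization ℂ B) := CStarAlgebra.spectralOrderedRing _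
  obtain ⟨hl, hr, hd⟩ := hJ
  let i : B →⋆ₙₐ[ℂ] Unitization ℂ B := Unitization.inrNonUnitalStarAlgHom ℂ B
  have hi : ∀ x, i x = (x : Unitization ℂ B) := fun x => rfl
  let J' : Submodule ℂ (Unitization ℂ B) := J.map (i : B →ₗ[ℂ] Unitization ℂ B)
  have hJ' : ∀ x, x ∈ J' ↔ ∃ j ∈ J, i j = x := fun x => Iff.rfl
  obtain ⟨H, _, _, _, π, hirr, hπJ, ξ, hξ, hfix⟩ :=
    exists_irreducible_of_le_norm_sub (J := J') (h := i (star b * b))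
      (by
        intro a x hx
        obtain ⟨j, hj, rfl⟩ := (hJ' x).1 hx
        refine (hJ' _).2 ⟨a.fst • j + a.snd * j, J.add_mem (J.smul_mem _ hj) (hl _ _ hj), ?_⟩
        rw [hi, hi]
        ext <;> simp)
      (by
        intro a x hx
        obtain ⟨j, hj, rfl⟩ := (hJ' x).1 hx
        refine (hJ' _).2 ⟨a.fst • j + j * a.snd, J.add_mem (J.smul_mem _ hj) (hr _ _ hj), ?_⟩
        rw [hi, hi]
        ext <;> simp)
      (by rw [map_mul, map_star]; exact star_mul_self_nonneg _)
      (by rw [hi, Unitization.norm_inr, hb])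
      (by
        intro x hx
        obtain ⟨j, hj, rfl⟩ := (hJ' x).1 hx
        rw [← map_sub, hi, Unitization.norm_inr]
        exact hd j hj)
  have hξ0 : ξ ≠ 0 := by
    rintro rfl
    simp at hξ
  let ρ : B →⋆ₙₐ[ℂ] (H →L[ℂ] H) := (π : Unitization ℂ B →⋆ₙₐ[ℂ] (H →L[ℂ] H)).comp i
  have hρ : ∀ x, ρ x = π (i x) := fun x => rfl
  refine ⟨H, _, _, _, ρ, ⟨⟨star b * b, fun h0 => hξ0 ?_⟩, fun K hK hinv => ?_⟩,
    fun j hj => hπJ _ ((hJ' _).2 ⟨j, hj, rfl⟩), ξ, hξ, hfix⟩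
  · rw [← hfix, ← hρ, h0, zero_apply]
  · refine hirr K hK fun a x hx => ?_
    have e : a = algebraMap ℂ _ a.fst + i a.snd := by
      rw [hi]
      ext <;> simp [Unitization.algebraMap_eq_inl]
    rw [e, map_add, AlgHomClass.commutes, add_apply]
    refine K.add_mem ?_ (hinv _ x hx)
    rw [Algebra.algebraMap_eq_smul_one, smul_apply, one_apply_eq_self]
    exact K.smul_mem _ hx

/-- In a type I algebra a norm-one normal element is not a limit of nilpotent elements. -/
theorem IsTypeI.notMem_closure_of_norm_eq_one (hB : IsTypeI B) {b : B} [hbn : IsStarNormal b]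
    (hb : ‖b‖ = 1) : b ∉ closure {x : B | IsNilpotentElement x} := by
  intro hmem
  have hh : ‖star b * b‖ = 1 := by rw [CStarRing.norm_star_mul_self, hb, one_mul]
  obtain ⟨J, hJ⟩ := exists_maximal_idealsFarFrom hh
  obtain ⟨H, _, _, _, π, hirr, hπJ, ξ, hξ, hfix⟩ := exists_isIrreducibleRep hh hJ.prop
  have hξ0 : ξ ≠ 0 := by
    rintro rfl
    simp at hξ
  have hJle : J ≤ compactPreimage π := by
    intro j hj
    rw [mem_compactPreimage, hπJ j hj]
    exact isCompactOperator_zero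
  -- A rank-one operator in the image of `π` shows that the inclusion `J ≤ π⁻¹(K(H))` is strict.
  have hnle : ¬ compactPreimage π ≤ J := by
    intro hle
    let R : H →L[ℂ] H := (innerSL ℂ ξ).smulRight ξ
    have hRc : IsCompactOperator R :=
      (isCompactOperator_of_locallyCompactSpace_dom (innerSL ℂ ξ)).clm_comp
        (ContinuousLinearMap.toSpanSingleton ℂ ξ)
    obtain ⟨c, hc⟩ := hB H π hirr R hRc
    have h0 : R = 0 := by
      rw [← hc]
      exact hπJ c (hle (by rw [mem_compactPreimage, hc]; exact hRc))
    have h2 : R ξ = ξ := by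
      simp [R, inner_self_eq_norm_sq_to_K, hξ]
    rw [h0, zero_apply] at h2
    exact hξ0 h2.symm
  -- By maximality of `J` some element of `π⁻¹(K(H))` is at distance less than `1` from `b⋆b`.
  obtain ⟨c, hc, hlt⟩ : ∃ c ∈ compactPreimage π, ‖star b * b - c‖ < 1 := by
    by_contra! hcon
    refine hnle (hJ.2 ⟨fun a j hj => ?_, fun a j hj => ?_, hcon⟩ hJle)
    · rw [mem_compactPreimage] at hj ⊢
      rw [map_mul]
      exact hj.clm_comp (π a)
    · rw [mem_compactPreimage] at hj ⊢
      rw [map_mul]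
      exact hj.comp_clm (π a)
  have hnorm : IsStarNormal (π b) := IsStarNormal.map π b
  refine notMem_closure_isNilpotent (T := π b) (k := π c)
    ((NonUnitalStarAlgHom.norm_apply_le π b).trans hb.le) hc ?_ hξ0 ?_ ?_
  · rw [← map_star, ← map_mul, ← map_sub]
    exact (NonUnitalStarAlgHom.norm_apply_le π _).trans_lt hlt
  · rw [← map_star, ← map_mul, hfix]
  · have h3 := map_mem_closure_isNilpotentElement π hmem
    simpa only [isNilpotentElement_iff] using h3

theorem IsTypeI.eq_zero_of_isStarNormal (hB : IsTypeI B) {b : B} [hbn : IsStarNormal b]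
    (hmem : b ∈ closure {x : B | IsNilpotentElement x}) : b = 0 := by
  by_contra hb
  have hpos : 0 < ‖b‖ := norm_pos_iff.2 hb
  set c : ℂ := (‖b‖ : ℂ)⁻¹
  have hcb : IsStarNormal (c • b) := by
    rw [isStarNormal_iff] at hbn ⊢
    rw [star_smul]
    exact (hbn.smul_left _).smul_right _
  refine hB.notMem_closure_of_norm_eq_one (b := c • b) ?_
    (map_mem_closure (continuous_const_smul c) hmem fun x hx => IsNilpotentElement.smul c hx)
  rw [norm_smul, norm_inv, Complex.norm_real, norm_norm, inv_mul_cancel₀ hpos.ne']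

end TypeI

theorem mainTheorem5 (A : Type u) [NonUnitalCStarAlgebra A]
    (h : ∃ a ∈ closure {b : A | IsNilpotentElement b}, IsStarNormal a ∧ a ≠ 0) :
    ¬ IsResiduallyTypeI.{u, v, w} A := by
  rintro ⟨ι, B, _, φ, hB, hsep⟩
  obtain ⟨a, ha, hn, h0⟩ := h
  obtain ⟨i, hi⟩ := hsep a h0
  have : IsStarNormal (φ i a) := IsStarNormal.map (φ i) a
  exact hi ((hB i).eq_zero_of_isStarNormal (map_mem_closure_isNilpotentElement (φ i) ha))
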